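/- Let $m\ge 1$, $d=2^m$, and let $\rho$ be a quantum state of $m$ qubits, i.e. a positive semidefinite complex $d\times d$ matrix with $\operatorname{tr}\rho=1$. Let $N\ge 1$. At each time step $t=1,2,\dots$ an observable $X_t$ is drawn uniformly at random from the $d^2-1$ $m$-qubit Pauli operators (tensor products of $I,\sigma_x,\sigma_y,\sigma_z$) other than the identity. It is measured on $N$ copies of $\rho$: given $X_t$, with $\Pi_\uparrow=\frac12(I+X_t)$ the projector onto the $+1$ eigenspace of $X_t$, the number $n_t$ of "up" outcomes is binomially distributed with parameters $N$ and $\operatorname{tr}(\rho\,\Pi_\uparrow)$, and the average outcome is $\hat y_t=(2n_t-N)/N$. The pairs $(X_t,n_t)$, $t\ge1$, are independent. Let $\delta\in(0,1)$, $\alpha\in(0,\frac12)$, $\beta\in(\frac12,1-\alpha)$, $0<\eta_0<\frac12$, and $\eta_t=\eta_0/t^{\beta}$. Define the matrix-exponentiated-gradient (MEG) estimates by $\hat\rho_1=I/d$ and $$G_{t+1}=\log\hat\rho_t-2\eta_t\bigl(\operatorname{tr}(\hat\rho_tX_t)-\hat y_t\bigr)X_t,\qquad \hat\rho_{t+1}=\frac{\exp(G_{t+1})}{\operatorname{tr}\exp(G_{t+1})}\qquad(t\ge1).$$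 Set $$T_0=\left(\frac{\frac{d^2-1}{\eta_0 d}\left(\log d+\frac{2}{N}\,\frac{\eta_0^2}{1-2\eta_0}\,\zeta(2\beta)\right)+2}{\delta}\right)^{\frac{3}{1-\alpha-\beta}},$$ where $\zeta$ is the Riemann zeta function. Then for every integer $T>T_0$, $$\Pr\left\{\|\hat\rho_t-\rho\|_F^2<\frac1{t^{\alpha}}\right\}\ge 1-\delta,$$ where $\|\cdot\|_F$ is the Frobenius norm and the probability is taken over the measurement choices and outcomes and over $t$ uniform in $\{1,\dots,T\}$, independent of them. Moreover, $$\lim_{T\to\infty}\Pr\left\{\|\hat\rho_t-\rho\|_F^2<\frac1{t^{\alpha}}\right\}=1.$$ -/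

import Mathlib

open MeasureTheory ProbabilityTheory Filter Topology
open scoped ComplexOrder Matrix

/-- The single-qubit Pauli matrices, in the order `I, X, Y, Z`. -/
def pauli : Fin 4 → Matrix (Fin 2) (Fin 2) ℂ :=
  ![1, !![0, 1; 1, 0], !![0, -Complex.I; Complex.I, 0], !![1, 0; 0, -1]]

/-- Square complex matrices on the `2 ^ m`-dimensional space of `m` qubits, indexed by the
computational basis `Fin m → Fin 2`. -/
abbrev QubitMatrix (m : ℕ) := Matrix (Fin m → Fin 2) (Fin m → Fin 2) ℂ

/-- The Pauli operator `σ_{s 0} ⊗ ⋯ ⊗ σ_{s (m - 1)}` on `m` qubits. -/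
def pauliOp {m : ℕ} (s : Fin m → Fin 4) : QubitMatrix m :=
  Matrix.of fun x y => ∏ i, pauli (s i) (x i) (y i)

/-- Labels of the `d ^ 2 - 1` Pauli operators other than the identity, where `d = 2 ^ m`. -/
abbrev PauliLabel (m : ℕ) := {s : Fin m → Fin 4 // s ≠ 0}

/-- A quantum state: a positive semidefinite matrix with trace one. -/
def IsDensityMatrix {m : ℕ} (ρ : QubitMatrix m) : Prop :=
  ρ.PosSemidef ∧ ρ.trace = 1

lemma pauli_isHermitian (k : Fin 4) : (pauli k).IsHermitian := by
  fin_cases k <;> ext i j <;> fin_cases i <;> fin_cases j <;> simp [pauli]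

lemma pauli_mul_self (k : Fin 4) : pauli k * pauli k = 1 := by
  fin_cases k <;> ext i j <;> fin_cases i <;> fin_cases j <;>
    simp [pauli, Matrix.mul_apply, Fin.sum_univ_two]

lemma pauliOp_isHermitian {m : ℕ} (s : Fin m → Fin 4) : (pauliOp s).IsHermitian := by
  ext x y
  simp only [Matrix.conjTranspose_apply, pauliOp, Matrix.of_apply, star_prod]
  exact Finset.prod_congr rfl fun i _ => (pauli_isHermitian (s i)).apply _ _

lemma pauliOp_mul_self {m : ℕ} (s : Fin m → Fin 4) : pauliOp s * pauliOp s = 1 := by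
  ext x z
  have h : ∏ i, ∑ b, pauli (s i) (x i) b * pauli (s i) b (z i) =
      ∑ y : Fin m → Fin 2, ∏ i, pauli (s i) (x i) (y i) * pauli (s i) (y i) (z i) := by
    rw [Finset.prod_univ_sum, Fintype.piFinset_univ]
  simp only [Matrix.mul_apply, pauliOp, Matrix.of_apply, ← Finset.prod_mul_distrib]
  rw [← h]
  simp only [← Matrix.mul_apply, pauli_mul_self, Matrix.one_apply, Fintype.prod_ite_zero,
    funext_iff]
  simp

/-- The projector onto the eigenspace of the Pauli operator with eigenvalue `+1`. -/
noncomputable def upProj {m : ℕ} (s : Fin m → Fin 4) : QubitMatrix m :=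
  (1 / 2 : ℂ) • (1 + pauliOp s)

/-- The projector onto the eigenspace of the Pauli operator with eigenvalue `-1`. -/
noncomputable def downProj {m : ℕ} (s : Fin m → Fin 4) : QubitMatrix m :=
  (1 / 2 : ℂ) • (1 - pauliOp s)

lemma trace_mul_proj_nonneg {m : ℕ} {ρ Q : QubitMatrix m} (hρ : ρ.PosSemidef)
    (hQ : Q.IsHermitian) (hQQ : Q * Q = Q) : 0 ≤ (ρ * Q).trace.re := by
  have h : (ρ * Q).trace = (Qᴴ * ρ * Q).trace := by
    rw [hQ.eq, Matrix.mul_assoc, Matrix.trace_mul_comm Q, Matrix.mul_assoc, hQQ]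
  rw [h]
  exact (Complex.le_def.1 (hρ.conjTranspose_mul_mul_same Q).trace_nonneg).1

lemma born_mem_unitInterval {m : ℕ} {ρ : QubitMatrix m} (hρ : IsDensityMatrix ρ)
    (s : Fin m → Fin 4) : (ρ * upProj s).trace.re ∈ unitInterval := by
  have hH := pauliOp_isHermitian s
  have hS := pauliOp_mul_self s
  have hup : 0 ≤ (ρ * upProj s).trace.re := by
    refine trace_mul_proj_nonneg hρ.1 ?_ ?_
    · simp [Matrix.IsHermitian, upProj, Matrix.conjTranspose_smul, hH.eq]
    · simp only [upProj, smul_mul_smul_comm, add_mul, mul_add, hS, one_mul, mul_one]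
      module
  have hdown : 0 ≤ (ρ * downProj s).trace.re := by
    refine trace_mul_proj_nonneg hρ.1 ?_ ?_
    · simp [Matrix.IsHermitian, downProj, Matrix.conjTranspose_smul, hH.eq]
    · simp only [downProj, smul_mul_smul_comm, sub_mul, mul_sub, hS, one_mul, mul_one]
      module
  have hsum : (ρ * upProj s).trace.re + (ρ * downProj s).trace.re = 1 := by
    rw [← Complex.add_re, ← Matrix.trace_add, ← mul_add]
    have : upProj s + downProj s = 1 := by simp only [upProj, downProj]; module
    rw [this, mul_one, hρ.2, Complex.one_re]
  exact ⟨hup, by linarith⟩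

/-- Born's rule: the probability of the outcome "up" when the Pauli operator with label `s` is
measured in the state `ρ`. -/
noncomputable def bornUp {m : ℕ} (ρ : QubitMatrix m) (hρ : IsDensityMatrix ρ)
    (s : Fin m → Fin 4) : unitInterval :=
  ⟨(ρ * upProj s).trace.re, born_mem_unitInterval hρ s⟩

/-- Joint law of one round of measurements: the label of a Pauli operator is uniform among all
labels other than that of the identity and, given the label `s`, the number of "up" outcomes in
`N` shots is binomial with parameters `N` and `bornUp ρ hρ s`. -/
noncomputable def roundLaw {m : ℕ} (N : ℕ) (ρ : QubitMatrix m) (hρ : IsDensityMatrix ρ) :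
    Measure (PauliLabel m × ℕ) :=
  (uniformOn (Set.univ : Set (PauliLabel m))) ⊗ₘ
    (Kernel.ofFunOfCountable fun s : PauliLabel m => binomial N (bornUp ρ hρ s.1))

/-- The average outcome `(n_up - n_down) / N` of `N` shots, `n` of them being "up". -/
noncomputable def averageOutcome (N n : ℕ) : ℝ :=
  (2 * (n : ℝ) - N) / N

/-- The matrix-exponentiated-gradient update with estimate `σ`, observable `X`, average
outcome `y` and learning rate `η`. The matrix logarithm is taken by functional calculus. -/
noncomputable def megUpdate {m : ℕ} (σ X : QubitMatrix m) (y η : ℝ) : QubitMatrix m :=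
  let G : QubitMatrix m := cfc Real.log σ - (2 * η * ((σ * X).trace.re - y)) • X
  (NormedSpace.exp G).trace⁻¹ • NormedSpace.exp G

/-- The estimate at time step `t ≥ 1`: it is the maximally mixed state at time `1`, and the one
at time `t + 1` is the update of the one at time `t` with the data `X t`, `y t` and the learning
rate `η t`. The value at `t = 0` is not used. -/
noncomputable def megEstimate {m : ℕ} (η : ℕ → ℝ) (X : ℕ → QubitMatrix m) (y : ℕ → ℝ) :
    ℕ → QubitMatrix m
  | 0 => ((2 : ℝ) ^ m)⁻¹ • 1
  | 1 => ((2 : ℝ) ^ m)⁻¹ • 1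
  | t + 2 => megUpdate (megEstimate η X y (t + 1)) (X (t + 1)) (y (t + 1)) (η (t + 1))

section
open scoped Matrix.Norms.Frobenius

/-- The Frobenius norm of a matrix. -/
noncomputable def frobeniusNorm {m : ℕ} (A : QubitMatrix m) : ℝ := ‖A‖

end

/-! The cross entropy `-tr (ρ log ρ̂_t)` is a Lyapunov function. It differs from the relative
entropy of `ρ` to `ρ̂_t` by a constant, is nonnegative and starts at `log d`. Write `a = tr (ρ̂ X)`,
`b = tr (ρ X)`, `u = a - b`.

The update subtracts `c X` from `log ρ̂_t`, with `c = 2 η (a - y)`, and renormalizes. The cost of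
renormalizing is the free energy `log tr exp (H - c X) ≤ -c tr (X exp H) + c² / 2`, a consequence of
a Pinsker inequality for observables with `X² = 1`. Hence the cross entropy drops by at least `2 η
(a - y) u - 2 η² (a - y)²` (`crossEntropy_megUpdate_le`). Given `X`, `a - y` has mean `u` and
variance at most `1 / N`; since `η ≤ 1 / 2`, the mean drop is at least `η u² - 2 η² / N`. By
completeness of the Pauli operators, averaging `u²` over `X` gives `d / (d² - 1) · ‖ρ̂ - ρ‖_F²`
(`lintegral_crossEntropy_megUpdate_le`).

Each round is independent of the past, so these bounds telescope: with `c = η₀ d / (d² - 1)`, the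
sum of `c t^(-β) E ‖ρ̂_t - ρ‖_F²` is at most `K = log d + 2 η₀² ζ(2β) / N`. Markov's inequality at
each `t`, averaged over `t ≤ T`, bounds the failure probability by `(K / c) T^(-(1 - α - β))`, which
gives both claims. -/

/-! ### Spectral calculus and a Pinsker inequality -/

section MatrixInequalities

variable {n : Type*} [Fintype n] [DecidableEq n]

theorem Matrix.IsHermitian.eq_conj_diagonal {A : Matrix n n ℂ} (hA : A.IsHermitian) :
    A = (hA.eigenvectorUnitary : Matrix n n ℂ) *
      Matrix.diagonal (fun i => (hA.eigenvalues i : ℂ)) *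
        (hA.eigenvectorUnitary : Matrix n n ℂ)ᴴ := by
  conv_lhs => rw [hA.spectral_theorem]
  rfl

theorem Matrix.IsHermitian.exp_eq_conj_diagonal {A : Matrix n n ℂ} (hA : A.IsHermitian) :
    NormedSpace.exp A = (hA.eigenvectorUnitary : Matrix n n ℂ) *
      Matrix.diagonal (fun i => (Real.exp (hA.eigenvalues i) : ℂ)) *
        (hA.eigenvectorUnitary : Matrix n n ℂ)ᴴ := by
  have hU : (hA.eigenvectorUnitary : Matrix n n ℂ)ᴴ * (hA.eigenvectorUnitary : Matrix n n ℂ) = 1 :=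
    Unitary.coe_star_mul_self _
  have hinv : (hA.eigenvectorUnitary : Matrix n n ℂ)ᴴ =
      (hA.eigenvectorUnitary : Matrix n n ℂ)⁻¹ := (Matrix.inv_eq_left_inv hU).symm
  conv_lhs => rw [hA.eq_conj_diagonal, hinv]
  rw [Matrix.exp_conj _ _ ((Matrix.isUnit_iff_isUnit_det _).2
    (Matrix.isUnit_det_of_left_inverse hU)), Matrix.exp_diagonal, ← hinv]
  congr 3
  ext i
  rw [Pi.coe_exp, Complex.ofReal_exp, Complex.exp_eq_exp_ℂ]

theorem Matrix.IsHermitian.exp_eq_cfc {A : Matrix n n ℂ} (hA : A.IsHermitian) :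
    NormedSpace.exp A = cfc Real.exp A := by
  rw [hA.exp_eq_conj_diagonal, hA.cfc_eq]
  rfl

theorem Matrix.IsHermitian.cfc_log_exp {A : Matrix n n ℂ} (hA : A.IsHermitian) :
    cfc Real.log (NormedSpace.exp A) = A := by
  have hA' : IsSelfAdjoint A := hA
  have hcont : ContinuousOn Real.log (Real.exp '' spectrum ℝ A) := by fun_prop (disch := simp)
  rw [hA.exp_eq_cfc, ← cfc_comp' Real.log Real.exp A hcont]
  simp [cfc_id' (R := ℝ) A]

theorem Matrix.sum_normSq_row {M : Matrix n n ℂ} (h : M * Mᴴ = 1) (i : n) :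
    ∑ j, Complex.normSq (M i j) = 1 := by
  have := congrFun (congrFun h i) i
  simp only [Matrix.mul_apply, Matrix.conjTranspose_apply, Matrix.one_apply_eq,
    RCLike.star_def, Complex.mul_conj] at this
  exact_mod_cast this

theorem Matrix.sum_normSq_col {M : Matrix n n ℂ} (h : Mᴴ * M = 1) (j : n) :
    ∑ i, Complex.normSq (M i j) = 1 := by
  have := congrFun (congrFun h j) j
  simp only [Matrix.mul_apply, Matrix.conjTranspose_apply, Matrix.one_apply_eq,
    RCLike.star_def, mul_comm (starRingEnd ℂ _), Complex.mul_conj] at this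
  exact_mod_cast this

theorem Matrix.trace_conj_diagonal {U : Matrix n n ℂ} (h : Uᴴ * U = 1) (a : n → ℝ) :
    (U * Matrix.diagonal (fun i => (a i : ℂ)) * Uᴴ).trace.re = ∑ i, a i := by
  rw [Matrix.trace_mul_comm, ← mul_assoc, h, one_mul, Matrix.trace_diagonal]
  simp

theorem Matrix.trace_conj_diagonal_mul_conj_diagonal (U V : Matrix n n ℂ) (a b : n → ℝ) :
    (U * Matrix.diagonal (fun i => (a i : ℂ)) * Uᴴ *
      (V * Matrix.diagonal (fun i => (b i : ℂ)) * Vᴴ)).trace.re =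
      ∑ i, ∑ j, Complex.normSq ((Uᴴ * V) i j) * (a i * b j) := by
  have : (U * Matrix.diagonal (fun i => (a i : ℂ)) * Uᴴ *
      (V * Matrix.diagonal (fun i => (b i : ℂ)) * Vᴴ)).trace =
      ((Matrix.diagonal (fun i => (a i : ℂ)) * (Uᴴ * V)) *
        (Matrix.diagonal (fun i => (b i : ℂ)) * (Uᴴ * V)ᴴ)).trace := by
    rw [Matrix.conjTranspose_mul, Matrix.conjTranspose_conjTranspose, mul_assoc U, mul_assoc U,
      Matrix.trace_mul_comm U]
    simp only [mul_assoc]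
  rw [this, Matrix.trace]
  simp only [Matrix.diag_apply, Matrix.mul_apply (n := n) (M := Matrix.diagonal _ * _),
    Matrix.diagonal_mul, Matrix.conjTranspose_apply, Complex.re_sum]
  refine Finset.sum_congr rfl fun i _ => Finset.sum_congr rfl fun j _ => ?_
  rw [show (a i : ℂ) * (Uᴴ * V) i j * ((b j : ℂ) * star ((Uᴴ * V) i j)) =
    ((Complex.normSq ((Uᴴ * V) i j) * (a i * b j) : ℝ) : ℂ) by
      rw [Complex.ofReal_mul, Complex.ofReal_mul, ← Complex.mul_conj, RCLike.star_def]; ring]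
  exact Complex.ofReal_re _

theorem Matrix.trace_mul_conj_diagonal_left {U V : Matrix n n ℂ} (hV : V * Vᴴ = 1)
    (X : Matrix n n ℂ) (a : n → ℝ) :
    (X * (U * Matrix.diagonal (fun i => (a i : ℂ)) * Uᴴ)).trace.re =
      ∑ i, ∑ j, a i * ((Uᴴ * X * V) i j * star ((Uᴴ * V) i j)).re := by
  have : (X * (U * Matrix.diagonal (fun i => (a i : ℂ)) * Uᴴ)).trace =
      (Matrix.diagonal (fun i => (a i : ℂ)) * ((Uᴴ * X * V) * (Uᴴ * V)ᴴ)).trace := by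
    rw [Matrix.conjTranspose_mul, Matrix.conjTranspose_conjTranspose, mul_assoc (Uᴴ * X),
      ← mul_assoc V, hV, one_mul, Matrix.trace_mul_comm, Matrix.mul_assoc, Matrix.mul_assoc,
      Matrix.trace_mul_comm U, mul_assoc, mul_assoc]
  rw [this, Matrix.trace]
  simp only [Matrix.diag_apply, Matrix.diagonal_mul, Matrix.mul_apply (n := n) (N := (Uᴴ * V)ᴴ),
    Matrix.conjTranspose_apply, Complex.re_sum, Complex.re_ofReal_mul, Finset.mul_sum]

theorem Matrix.trace_mul_conj_diagonal_right {U V X : Matrix n n ℂ} (hU : U * Uᴴ = 1)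
    (hX : X.IsHermitian) (b : n → ℝ) :
    (X * (V * Matrix.diagonal (fun i => (b i : ℂ)) * Vᴴ)).trace.re =
      ∑ i, ∑ j, b j * ((Uᴴ * X * V) i j * star ((Uᴴ * V) i j)).re := by
  rw [Matrix.trace_mul_conj_diagonal_left hU, Finset.sum_comm]
  refine Finset.sum_congr rfl fun i _ => Finset.sum_congr rfl fun j _ => ?_
  have h1 : (Vᴴ * X * U) j i = star ((Uᴴ * X * V) i j) := by
    rw [← Matrix.conjTranspose_apply, Matrix.conjTranspose_mul, Matrix.conjTranspose_mul, hX.eq,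
      Matrix.conjTranspose_conjTranspose, mul_assoc]
  have h2 : (Vᴴ * U) j i = star ((Uᴴ * V) i j) := by
    rw [← Matrix.conjTranspose_apply, Matrix.conjTranspose_mul, Matrix.conjTranspose_conjTranspose]
  rw [h1, h2]
  simp

/-- The difference of the two sides vanishes at `1`, and its derivative `2 ((y + 1) log y - 2 (y -
1))` has the sign of `y - 1`. -/
theorem Real.sq_sub_one_le_entropy {x : ℝ} (hx : 0 < x) :
    3 / 2 * (x - 1) ^ 2 ≤ (x + 2) * (x * Real.log x - x + 1) := by
  set f : ℝ → ℝ := fun x => (x + 2) * (x * Real.log x - x + 1) - 3 / 2 * (x - 1) ^ 2 with hf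
  have hd : ∀ y : ℝ, 0 < y →
      HasDerivAt f (2 * ((y + 1) * Real.log y - 2 * (y - 1))) y := by
    intro y hy
    have h1 := ((hasDerivAt_id y).add_const 2).mul
      (((Real.hasDerivAt_mul_log hy.ne').sub (hasDerivAt_id y)).add_const 1)
    have h2 := (((hasDerivAt_id y).sub_const 1).pow 2).const_mul (3 / 2)
    refine (h1.sub h2).congr_deriv ?_
    simp
    ring
  have hlog : ∀ y : ℝ, 1 ≤ y → 2 * (y - 1) ≤ (y + 1) * Real.log y := by
    intro y hy
    have := Real.le_log_one_add_of_nonneg (x := y - 1) (by linarith)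
    rw [div_le_iff₀ (by linarith), show 1 + (y - 1) = y by ring] at this
    nlinarith
  have hlog' : ∀ y : ℝ, 0 < y → y ≤ 1 → (y + 1) * Real.log y ≤ 2 * (y - 1) := by
    intro y hy hy1
    -- The bound below `1` is the bound above `1` at the reciprocal.
    have := hlog y⁻¹ ((one_le_inv₀ hy).2 hy1)
    rw [Real.log_inv] at this
    have h2 := mul_le_mul_of_nonneg_left this hy.le
    have h3 : y * (2 * (y⁻¹ - 1)) = 2 * (1 - y) := by field_simp
    have h4 : y * ((y⁻¹ + 1) * -Real.log y) = -((y + 1) * Real.log y) := by field_simp; ring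
    linarith
  have h0 : f 1 = 0 := by simp [hf]
  suffices 0 ≤ f x by simp only [hf] at this; linarith
  rcases le_total 1 x with h | h
  · have hm : MonotoneOn f (Set.Ici 1) := by
      refine monotoneOn_of_deriv_nonneg (convex_Ici 1) (fun y hy => ?_) (fun y hy => ?_)
        (fun y hy => ?_)
      · exact (hd y (lt_of_lt_of_le one_pos hy)).continuousAt.continuousWithinAt
      · rw [interior_Ici] at hy
        exact (hd y (one_pos.trans hy)).differentiableAt.differentiableWithinAt
      · rw [interior_Ici] at hy
        rw [(hd y (one_pos.trans hy)).deriv]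
        linarith [hlog y (le_of_lt hy)]
    rw [← h0]
    exact hm (Set.mem_Ici.2 le_rfl) h h
  · have hm : AntitoneOn f (Set.Ioc 0 1) := by
      refine antitoneOn_of_deriv_nonpos (convex_Ioc 0 1) (fun y hy => ?_) (fun y hy => ?_)
        (fun y hy => ?_)
      · exact (hd y hy.1).continuousAt.continuousWithinAt
      · rw [interior_Ioc] at hy
        exact (hd y hy.1).differentiableAt.differentiableWithinAt
      · rw [interior_Ioc] at hy
        rw [(hd y hy.1).deriv]
        linarith [hlog' y hy.1 hy.2.le]
    rw [← h0]
    exact hm ⟨hx, h⟩ ⟨one_pos, le_rfl⟩ h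

/-- This is `Real.sq_sub_one_le_entropy` at `x = exp (g - h)`, scaled by `exp (2 h)`. The factor `2
/ 3 * (p + 2 q)` becomes Pinsker's constant `2` once `p` and `q` are replaced by traces equal to
one. -/
theorem Real.sq_exp_sub_exp_le (g h : ℝ) :
    (Real.exp g - Real.exp h) ^ 2 ≤ 2 / 3 * (Real.exp g + 2 * Real.exp h) *
      (Real.exp g * (g - h) - Real.exp g + Real.exp h) := by
  have hx := Real.sq_sub_one_le_entropy (Real.exp_pos (g - h))
  rw [Real.log_exp] at hx
  have hg : Real.exp g = Real.exp h * Real.exp (g - h) := by rw [← Real.exp_add]; ring_nf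
  rw [hg]
  nlinarith [mul_le_mul_of_nonneg_left hx (sq_nonneg (Real.exp h))]

/-- Pinsker's inequality for the expectation of an observable squaring to one. -/
theorem Matrix.IsHermitian.sq_trace_mul_exp_sub_exp_le {G H X : Matrix n n ℂ}
    (hG : G.IsHermitian) (hH : H.IsHermitian) (hX : X.IsHermitian) (hXX : X * X = 1) :
    ((X * NormedSpace.exp G).trace.re - (X * NormedSpace.exp H).trace.re) ^ 2 ≤
      2 / 3 * ((NormedSpace.exp G).trace.re + 2 * (NormedSpace.exp H).trace.re) *
        ((NormedSpace.exp G * G).trace.re - (NormedSpace.exp G * H).trace.re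
          - (NormedSpace.exp G).trace.re + (NormedSpace.exp H).trace.re) := by
  rw [hG.exp_eq_conj_diagonal, hH.exp_eq_conj_diagonal]
  set U := (hG.eigenvectorUnitary : Matrix n n ℂ) with hUdef
  set V := (hH.eigenvectorUnitary : Matrix n n ℂ) with hVdef
  set g := hG.eigenvalues
  set h := hH.eigenvalues
  have hU1 : Uᴴ * U = 1 := Unitary.coe_star_mul_self _
  have hU2 : U * Uᴴ = 1 := Unitary.coe_mul_star_self _
  have hV1 : Vᴴ * V = 1 := Unitary.coe_star_mul_self _
  have hV2 : V * Vᴴ = 1 := Unitary.coe_mul_star_self _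
  -- Both `W` and `Y` are unitary, `Y` because `X` is Hermitian with `X² = 1`. The squared moduli of
  -- their entries are therefore doubly stochastic, and either array may serve as weights when a
  -- trace is written as a double sum.
  set W := Uᴴ * V with hW
  set Y := Uᴴ * X * V with hY
  have hWt : Wᴴ = Vᴴ * U := by simp [hW, Matrix.conjTranspose_mul]
  have hYt : Yᴴ = Vᴴ * X * U := by simp [hY, Matrix.conjTranspose_mul, hX.eq, mul_assoc]
  have hW1 : W * Wᴴ = 1 := by
    rw [hWt, hW, mul_assoc, ← mul_assoc V, hV2, one_mul, hU1]
  have hW2 : Wᴴ * W = 1 := by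
    rw [hWt, hW, mul_assoc, ← mul_assoc U, hU2, one_mul, hV1]
  have hY1 : Y * Yᴴ = 1 := by
    rw [hYt, hY, mul_assoc, ← mul_assoc V, ← mul_assoc V, hV2, one_mul, mul_assoc, ← mul_assoc X,
      hXX, one_mul, hU1]
  have hY2 : Yᴴ * Y = 1 := by
    rw [hYt, hY, mul_assoc, ← mul_assoc U, ← mul_assoc U, hU2, one_mul, mul_assoc, ← mul_assoc X,
      hXX, one_mul, hV1]
  have e1 : (U * Matrix.diagonal (fun i => (Real.exp (g i) : ℂ)) * Uᴴ * G).trace.re =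
      ∑ i, ∑ j, Complex.normSq (W i j) * (Real.exp (g i) * g i) := by
    conv_lhs => rw [hG.eq_conj_diagonal]
    rw [Matrix.trace_conj_diagonal_mul_conj_diagonal]
    -- Both eigenbases are `U` here, so only diagonal terms survive.
    simp only [← hUdef, hU1, ← Finset.sum_mul, Matrix.sum_normSq_row hW1]
    refine Finset.sum_congr rfl fun i _ => ?_
    rw [Finset.sum_eq_single i] <;> simp +contextual [eq_comm]
    exact Or.inl rfl
  have e2 : (U * Matrix.diagonal (fun i => (Real.exp (g i) : ℂ)) * Uᴴ * H).trace.re =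
      ∑ i, ∑ j, Complex.normSq (W i j) * (Real.exp (g i) * h j) := by
    conv_lhs => rw [hH.eq_conj_diagonal]
    exact Matrix.trace_conj_diagonal_mul_conj_diagonal _ _ _ _
  have e3 : (U * Matrix.diagonal (fun i => (Real.exp (g i) : ℂ)) * Uᴴ).trace.re =
      ∑ i, ∑ j, Complex.normSq (W i j) * Real.exp (g i) := by
    rw [Matrix.trace_conj_diagonal hU1]
    simp only [← Finset.sum_mul, Matrix.sum_normSq_row hW1, one_mul]
  have e4 : (V * Matrix.diagonal (fun i => (Real.exp (h i) : ℂ)) * Vᴴ).trace.re =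
      ∑ i, ∑ j, Complex.normSq (W i j) * Real.exp (h j) := by
    rw [Matrix.trace_conj_diagonal hV1, Finset.sum_comm]
    simp only [← Finset.sum_mul, Matrix.sum_normSq_col hW2, one_mul]
  have e3' : (U * Matrix.diagonal (fun i => (Real.exp (g i) : ℂ)) * Uᴴ).trace.re =
      ∑ i, ∑ j, Complex.normSq (Y i j) * Real.exp (g i) := by
    rw [Matrix.trace_conj_diagonal hU1]
    simp only [← Finset.sum_mul, Matrix.sum_normSq_row hY1, one_mul]
  have e4' : (V * Matrix.diagonal (fun i => (Real.exp (h i) : ℂ)) * Vᴴ).trace.re =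
      ∑ i, ∑ j, Complex.normSq (Y i j) * Real.exp (h j) := by
    rw [Matrix.trace_conj_diagonal hV1, Finset.sum_comm]
    simp only [← Finset.sum_mul, Matrix.sum_normSq_col hY2, one_mul]
  -- The prefactor is spread with the weights of `Y`, the entropy with those of `W`; the trace
  -- difference carries the mixed weights `Re (Y conj W)`, as Cauchy–Schwarz requires.
  have eL : 2 / 3 * ((U * Matrix.diagonal (fun i => (Real.exp (g i) : ℂ)) * Uᴴ).trace.re +
      2 * (V * Matrix.diagonal (fun i => (Real.exp (h i) : ℂ)) * Vᴴ).trace.re) =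
      ∑ p : n × n, Complex.normSq (Y p.1 p.2) *
        (2 / 3 * (Real.exp (g p.1) + 2 * Real.exp (h p.2))) := by
    rw [e3', e4', Fintype.sum_prod_type]
    simp only [Finset.mul_sum, ← Finset.sum_add_distrib]
    exact Finset.sum_congr rfl fun i _ => Finset.sum_congr rfl fun j _ => by ring
  rw [eL, e1, e2, e3, e4, Matrix.trace_mul_conj_diagonal_left hV2,
    Matrix.trace_mul_conj_diagonal_right hU2 hX, ← hW, ← hY]
  simp only [← Finset.sum_sub_distrib, ← Finset.sum_add_distrib]
  rw [← Fintype.sum_prod_type', ← Fintype.sum_prod_type']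
  refine Finset.sum_sq_le_sum_mul_sum_of_sq_le_mul _ (fun p _ => ?_) (fun p _ => ?_) (fun p _ => ?_)
  · have := Complex.normSq_nonneg (Y p.1 p.2)
    positivity
  · have h1 := Complex.normSq_nonneg (W p.1 p.2)
    have h2 := Real.sq_exp_sub_exp_le (g p.1) (h p.2)
    -- The entropy term is nonnegative since its product with a positive factor dominates a square.
    have h3 : 0 ≤ Real.exp (g p.1) * (g p.1 - h p.2) - Real.exp (g p.1) + Real.exp (h p.2) := by
      by_contra! hneg
      have : 0 < 2 / 3 * (Real.exp (g p.1) + 2 * Real.exp (h p.2)) := by positivity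
      nlinarith [sq_nonneg (Real.exp (g p.1) - Real.exp (h p.2))]
    nlinarith [mul_nonneg h1 h3]
  · have h1 : ((Y p.1 p.2 * star (W p.1 p.2)).re) ^ 2 ≤
        Complex.normSq (Y p.1 p.2) * Complex.normSq (W p.1 p.2) := by
      have : Complex.normSq (Y p.1 p.2 * star (W p.1 p.2)) =
          Complex.normSq (Y p.1 p.2) * Complex.normSq (W p.1 p.2) := by
        rw [Complex.normSq_mul, RCLike.star_def, Complex.normSq_conj]
      rw [← this, Complex.normSq_apply]
      nlinarith [sq_nonneg (Y p.1 p.2 * star (W p.1 p.2)).im]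
    have h2 := Real.sq_exp_sub_exp_le (g p.1) (h p.2)
    have h3 := mul_le_mul h2 h1 (sq_nonneg _) ((sq_nonneg _).trans h2)
    calc _ = (Real.exp (g p.1) - Real.exp (h p.2)) ^ 2 *
          ((Y p.1 p.2 * star (W p.1 p.2)).re) ^ 2 := by ring
      _ ≤ _ := h3
      _ = _ := by ring

end MatrixInequalities

/-! ### Trace-one exponentials and free energy -/

section Gibbs

theorem Matrix.IsHermitian.trace_im {n : Type*} [Fintype n] {A : Matrix n n ℂ}
    (hA : A.IsHermitian) : A.trace.im = 0 := by
  have : star A.trace = A.trace := by rw [← Matrix.trace_conjTranspose, hA.eq]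
  exact Complex.conj_eq_iff_im.1 this

theorem Matrix.IsHermitian.ofReal_trace_re {n : Type*} [Fintype n] {A : Matrix n n ℂ}
    (hA : A.IsHermitian) :
    (A.trace.re : ℂ) = A.trace :=
  Complex.ext (Complex.ofReal_re _) (by rw [hA.trace_im, Complex.ofReal_im])

theorem Matrix.IsHermitian.real_smul {n : Type*} {A : Matrix n n ℂ} (hA : A.IsHermitian) (r : ℝ) :
    (r • A).IsHermitian := by
  rw [Matrix.IsHermitian, Matrix.conjTranspose_smul, hA.eq, star_trivial]

variable {n : Type*} [Fintype n] [DecidableEq n]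

theorem Matrix.exp_sub_smul_one (A : Matrix n n ℂ) (r : ℝ) :
    NormedSpace.exp (A - r • (1 : Matrix n n ℂ)) = Real.exp (-r) • NormedSpace.exp A := by
  have h1 : NormedSpace.exp (-r • (1 : Matrix n n ℂ)) = Real.exp (-r) • (1 : Matrix n n ℂ) := by
    have : (-r • (1 : Matrix n n ℂ)) = Matrix.diagonal (fun _ => ((-r : ℝ) : ℂ)) := by
      ext i j
      by_cases hij : i = j <;> simp [hij]
    rw [this, Matrix.exp_diagonal]
    ext i j
    by_cases hij : i = j
    · subst hij
      rw [Matrix.diagonal_apply_eq, Pi.coe_exp, ← Complex.exp_eq_exp_ℂ, ← Complex.ofReal_exp]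
      simp
    · simp [hij]
  rw [sub_eq_add_neg, ← neg_smul, Matrix.exp_add_of_commute, h1, mul_smul_comm, mul_one]
  exact (Commute.one_right A).smul_right _

theorem Matrix.IsHermitian.trace_exp_re {A : Matrix n n ℂ} (hA : A.IsHermitian) :
    (NormedSpace.exp A).trace.re = ∑ i, Real.exp (hA.eigenvalues i) := by
  rw [hA.exp_eq_conj_diagonal, Matrix.trace_conj_diagonal (Unitary.coe_star_mul_self _)]

theorem Matrix.IsHermitian.trace_exp_re_pos [Nonempty n] {A : Matrix n n ℂ}
    (hA : A.IsHermitian) : 0 < (NormedSpace.exp A).trace.re := by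
  rw [hA.trace_exp_re]
  exact Finset.sum_pos (fun i _ => Real.exp_pos _) Finset.univ_nonempty

/-- The exponentials of the eigenvalues of `H` are positive and sum to one, so every eigenvalue is
at most zero. -/
theorem Matrix.PosSemidef.trace_mul_nonpos_of_trace_exp {A H : Matrix n n ℂ}
    (hA : A.PosSemidef) (hH : H.IsHermitian) (h1 : (NormedSpace.exp H).trace.re = 1) :
    (A * H).trace.re ≤ 0 := by
  have hle : ∀ j, hH.eigenvalues j ≤ 0 := by
    intro j
    rw [← Real.exp_le_one_iff, ← h1, hH.trace_exp_re]
    exact Finset.single_le_sum (f := fun i => Real.exp (hH.eigenvalues i))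
      (fun i _ => (Real.exp_pos _).le) (Finset.mem_univ j)
  have h2 := Matrix.trace_conj_diagonal_mul_conj_diagonal
    (hA.1.eigenvectorUnitary : Matrix n n ℂ) (hH.eigenvectorUnitary : Matrix n n ℂ)
    hA.1.eigenvalues hH.eigenvalues
  rw [← hA.1.eq_conj_diagonal, ← hH.eq_conj_diagonal] at h2
  rw [h2]
  exact Finset.sum_nonpos fun i _ => Finset.sum_nonpos fun j _ =>
    mul_nonpos_of_nonneg_of_nonpos (Complex.normSq_nonneg _)
      (mul_nonpos_of_nonneg_of_nonpos (hA.eigenvalues_nonneg i) (hle j))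

/-- The Hamiltonian `A` shifted by a constant so that its exponential has trace one. -/
noncomputable def Matrix.expNormalize (A : Matrix n n ℂ) : Matrix n n ℂ :=
  A - Real.log (NormedSpace.exp A).trace.re • (1 : Matrix n n ℂ)

theorem Matrix.IsHermitian.expNormalize {A : Matrix n n ℂ} (hA : A.IsHermitian) :
    A.expNormalize.IsHermitian :=
  hA.sub (Matrix.isHermitian_one.real_smul _)

theorem Matrix.IsHermitian.exp_expNormalize [Nonempty n] {A : Matrix n n ℂ} (hA : A.IsHermitian) :
    NormedSpace.exp A.expNormalize = (NormedSpace.exp A).trace.re⁻¹ • NormedSpace.exp A := by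
  rw [Matrix.expNormalize, Matrix.exp_sub_smul_one, Real.exp_neg, Real.exp_log hA.trace_exp_re_pos]

theorem Matrix.IsHermitian.trace_exp_expNormalize [Nonempty n] {A : Matrix n n ℂ}
    (hA : A.IsHermitian) : (NormedSpace.exp A.expNormalize).trace.re = 1 := by
  rw [hA.exp_expNormalize, Matrix.trace_smul, Complex.smul_re, smul_eq_mul,
    inv_mul_cancel₀ hA.trace_exp_re_pos.ne']

/-- Second-order bound on the free energy in the direction of an observable squaring to one. -/
theorem Matrix.IsHermitian.log_trace_exp_sub_le [Nonempty n] {H X : Matrix n n ℂ}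
    (hH : H.IsHermitian) (h1 : (NormedSpace.exp H).trace.re = 1) (hX : X.IsHermitian)
    (hXX : X * X = 1) (c : ℝ) :
    Real.log (NormedSpace.exp (H - c • X)).trace.re ≤
      -c * (X * NormedSpace.exp H).trace.re + c ^ 2 / 2 := by
  have hA : (H - c • X).IsHermitian := hH.sub (hX.real_smul c)
  set A := H - c • X with hAdef
  have hp := hA.expNormalize.sq_trace_mul_exp_sub_exp_le hH hX hXX
  have hG : A.expNormalize = H - c • X - Real.log (NormedSpace.exp A).trace.re • 1 := rfl
  set E := NormedSpace.exp A.expNormalize with hE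
  have hE1 : E.trace.re = 1 := hA.trace_exp_expNormalize
  rw [hG, mul_sub, mul_sub, mul_smul_comm, mul_smul_comm, mul_one, Matrix.trace_sub,
    Matrix.trace_sub, Matrix.trace_smul, Matrix.trace_smul, Complex.sub_re, Complex.sub_re,
    Complex.smul_re, Complex.smul_re, h1, hE1, Matrix.trace_mul_comm E X] at hp
  simp only [smul_eq_mul] at hp
  -- With `Δ = tr (X E) - tr (X exp H)`, Pinsker reads `Δ² ≤ 2 (-c tr (X E) - log Z)`. Hence `log Z
  -- ≤ -c tr (X exp H) - c Δ - Δ² / 2`, and completing the square gives `c² / 2`.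
  nlinarith [sq_nonneg ((X * E).trace.re - (X * NormedSpace.exp H).trace.re + c)]

end Gibbs

/-! ### The update and the cross entropy -/

section MEG

variable {m : ℕ}

/-- Gibbs states: exponentials of Hermitian matrices, with trace one. -/
def IsGibbsState (σ : QubitMatrix m) : Prop :=
  ∃ H : QubitMatrix m, H.IsHermitian ∧ (NormedSpace.exp H).trace.re = 1 ∧ σ = NormedSpace.exp H

/-- The cross entropy `-tr (ρ log σ)`. -/
noncomputable def crossEntropy (ρ σ : QubitMatrix m) : ℝ :=
  -(ρ * cfc Real.log σ).trace.re

theorem IsGibbsState.isHermitian {σ : QubitMatrix m} (hσ : IsGibbsState σ) : σ.IsHermitian := by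
  obtain ⟨H, hH, -, rfl⟩ := hσ
  exact hH.exp

theorem IsGibbsState.trace_eq_one {σ : QubitMatrix m} (hσ : IsGibbsState σ) : σ.trace = 1 := by
  rw [← hσ.isHermitian.ofReal_trace_re]
  obtain ⟨H, hH, h1, rfl⟩ := hσ
  rw [h1, Complex.ofReal_one]

theorem crossEntropy_nonneg {ρ σ : QubitMatrix m} (hρ : IsDensityMatrix ρ)
    (hσ : IsGibbsState σ) : 0 ≤ crossEntropy ρ σ := by
  obtain ⟨H, hH, h1, rfl⟩ := hσ
  rw [crossEntropy, hH.cfc_log_exp]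
  exact neg_nonneg.2 (hρ.1.trace_mul_nonpos_of_trace_exp hH h1)

theorem megUpdate_exp {H X : QubitMatrix m} (hH : H.IsHermitian) (hX : X.IsHermitian) (y η : ℝ) :
    megUpdate (NormedSpace.exp H) X y η = NormedSpace.exp
      (H - (2 * η * ((NormedSpace.exp H * X).trace.re - y)) • X).expNormalize := by
  have hA := hH.sub (hX.real_smul (2 * η * ((NormedSpace.exp H * X).trace.re - y)))
  rw [hA.exp_expNormalize, megUpdate, hH.cfc_log_exp]
  rw [← hA.exp.ofReal_trace_re, ← Complex.ofReal_inv, Complex.ofReal_re]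
  exact Complex.coe_smul _ _

theorem IsGibbsState.megUpdate {σ X : QubitMatrix m} (hσ : IsGibbsState σ) (hX : X.IsHermitian)
    (y η : ℝ) : IsGibbsState (megUpdate σ X y η) := by
  obtain ⟨H, hH, h1, rfl⟩ := hσ
  have hA := hH.sub (hX.real_smul (2 * η * ((NormedSpace.exp H * X).trace.re - y)))
  exact ⟨_, hA.expNormalize, hA.trace_exp_expNormalize, megUpdate_exp hH hX y η⟩

/-- The new logarithm is `H - c X - log Z`, so, as `tr ρ = 1`, the cross entropy changes by exactly
`c tr (ρ X) + log Z`; the free energy bound controls `log Z`. -/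
theorem crossEntropy_megUpdate_le {ρ σ X : QubitMatrix m} (hρ : ρ.trace = 1)
    (hσ : IsGibbsState σ) (hX : X.IsHermitian) (hXX : X * X = 1) (y η : ℝ) :
    crossEntropy ρ (megUpdate σ X y η) ≤ crossEntropy ρ σ
      - 2 * η * ((σ * X).trace.re - y) * ((σ * X).trace.re - (ρ * X).trace.re)
      + 2 * η ^ 2 * ((σ * X).trace.re - y) ^ 2 := by
  obtain ⟨H, hH, h1, rfl⟩ := hσ
  rw [megUpdate_exp hH hX]
  set c := 2 * η * ((NormedSpace.exp H * X).trace.re - y) with hc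
  have hA := hH.sub (hX.real_smul c)
  have hL := hH.log_trace_exp_sub_le h1 hX hXX c
  rw [crossEntropy, crossEntropy, hH.cfc_log_exp, hA.expNormalize.cfc_log_exp,
    Matrix.expNormalize, mul_sub, mul_sub, mul_smul_comm, mul_smul_comm, mul_one,
    Matrix.trace_sub, Matrix.trace_sub, Matrix.trace_smul, Matrix.trace_smul, Complex.sub_re,
    Complex.sub_re, Complex.smul_re, Complex.smul_re, hρ, Complex.one_re]
  rw [Matrix.trace_mul_comm X] at hL
  simp only [smul_eq_mul]
  have e : 2 * η ^ 2 * ((NormedSpace.exp H * X).trace.re - y) ^ 2 = c ^ 2 / 2 := by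
    rw [hc]; ring
  rw [e]
  linarith

theorem maximallyMixed_eq_exp (m : ℕ) :
    ((2 : ℝ) ^ m)⁻¹ • (1 : QubitMatrix m) =
      NormedSpace.exp ((0 : QubitMatrix m) - Real.log (2 ^ m) • (1 : QubitMatrix m)) := by
  rw [Matrix.exp_sub_smul_one, NormedSpace.exp_zero, Real.exp_neg, Real.exp_log (by positivity)]

theorem isHermitian_log_maximallyMixed (m : ℕ) :
    ((0 : QubitMatrix m) - Real.log (2 ^ m) • (1 : QubitMatrix m)).IsHermitian :=
  Matrix.isHermitian_zero.sub (Matrix.isHermitian_one.real_smul _)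

theorem isGibbsState_maximallyMixed (m : ℕ) :
    IsGibbsState (((2 : ℝ) ^ m)⁻¹ • (1 : QubitMatrix m)) := by
  refine ⟨_, isHermitian_log_maximallyMixed m, ?_, maximallyMixed_eq_exp m⟩
  rw [← maximallyMixed_eq_exp, Matrix.trace_smul, Matrix.trace_one, Complex.smul_re,
    Complex.natCast_re]
  simp

theorem crossEntropy_maximallyMixed {ρ : QubitMatrix m} (hρ : ρ.trace = 1) :
    crossEntropy ρ (((2 : ℝ) ^ m)⁻¹ • (1 : QubitMatrix m)) = Real.log (2 ^ m) := by
  rw [maximallyMixed_eq_exp, crossEntropy, (isHermitian_log_maximallyMixed m).cfc_log_exp,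
    mul_sub, mul_zero, mul_smul_comm, mul_one, Matrix.trace_sub, Matrix.trace_smul, hρ,
    Matrix.trace_zero, Complex.sub_re, Complex.smul_re]
  simp

theorem isGibbsState_megEstimate {η : ℕ → ℝ} {X : ℕ → QubitMatrix m}
    (hX : ∀ k, (X k).IsHermitian) (y : ℕ → ℝ) : ∀ t, IsGibbsState (megEstimate η X y t)
  | 0 => isGibbsState_maximallyMixed m
  | 1 => isGibbsState_maximallyMixed m
  | t + 2 => (isGibbsState_megEstimate hX y (t + 1)).megUpdate (hX _) _ _

/-- Only the rounds `1, …, t` enter the estimate at time `t + 1`, which makes it independent of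
round `t + 1`. -/
theorem megEstimate_congr {η : ℕ → ℝ} {X X' : ℕ → QubitMatrix m} {y y' : ℕ → ℝ} {t : ℕ}
    (hX : ∀ k < t, X (k + 1) = X' (k + 1)) (hy : ∀ k < t, y (k + 1) = y' (k + 1)) :
    megEstimate η X y (t + 1) = megEstimate η X' y' (t + 1) := by
  induction t with
  | zero => rfl
  | succ t ih =>
    simp only [megEstimate]
    rw [ih (fun k hk => hX k (by omega)) (fun k hk => hy k (by omega)), hX t (by omega),
      hy t (by omega)]

end MEG

/-! ### Completeness of the Pauli operators -/

section Pauli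

variable {m : ℕ}

theorem sum_pauli_mul_pauli (a b c e : Fin 2) :
    ∑ k, pauli k a b * pauli k c e = if a = e ∧ b = c then 2 else 0 := by
  fin_cases a <;> fin_cases b <;> fin_cases c <;> fin_cases e <;>
    simp [pauli, Fin.sum_univ_four] <;> norm_num

/-- The single-qubit completeness relation tensorizes: the sum over labels of a product over qubits
is a product of one-qubit sums. -/
theorem sum_pauliOp_mul_pauliOp (x y z w : Fin m → Fin 2) :
    ∑ s, pauliOp s x y * pauliOp s z w = if x = w ∧ y = z then 2 ^ m else 0 := by
  have h : ∏ i, ∑ k, pauli k (x i) (y i) * pauli k (z i) (w i) =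
      ∑ s : Fin m → Fin 4, ∏ i, pauli (s i) (x i) (y i) * pauli (s i) (z i) (w i) := by
    rw [Finset.prod_univ_sum, Fintype.piFinset_univ]
  simp only [pauliOp, Matrix.of_apply, ← Finset.prod_mul_distrib]
  rw [← h]
  simp only [sum_pauli_mul_pauli, Fintype.prod_ite_zero, funext_iff, forall_and]
  simp

theorem sum_sq_trace_mul_pauliOp (A : QubitMatrix m) :
    ∑ s, (A * pauliOp s).trace ^ 2 = 2 ^ m * (A * A).trace := by
  have h : ∀ s : Fin m → Fin 4, (A * pauliOp s).trace ^ 2 =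
      ∑ x, ∑ y, ∑ z, ∑ w, A x y * A z w * (pauliOp s y x * pauliOp s w z) := by
    intro s
    simp only [pow_two, Matrix.trace, Matrix.diag_apply, Matrix.mul_apply, Finset.sum_mul,
      Finset.mul_sum]
    refine Finset.sum_congr rfl fun x _ => Finset.sum_congr rfl fun y _ =>
      Finset.sum_congr rfl fun z _ => Finset.sum_congr rfl fun w _ => by ring
  simp only [h]
  have h2 : ∑ s : Fin m → Fin 4, ∑ x, ∑ y, ∑ z, ∑ w,
      A x y * A z w * (pauliOp s y x * pauliOp s w z) =
      ∑ x, ∑ y, ∑ z, ∑ w, A x y * A z w * ∑ s, (pauliOp s y x * pauliOp s w z) := by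
    simp only [Finset.mul_sum]
    rw [Finset.sum_comm]; refine Finset.sum_congr rfl fun x _ => ?_
    rw [Finset.sum_comm]; refine Finset.sum_congr rfl fun y _ => ?_
    rw [Finset.sum_comm]; refine Finset.sum_congr rfl fun z _ => ?_
    rw [Finset.sum_comm]
  rw [h2]
  simp only [sum_pauliOp_mul_pauliOp, Matrix.trace, Matrix.diag_apply, Matrix.mul_apply,
    Finset.mul_sum]
  refine Finset.sum_congr rfl fun x _ => Finset.sum_congr rfl fun y _ => ?_
  rw [Finset.sum_eq_single y, Finset.sum_eq_single x]
  · rw [if_pos ⟨rfl, rfl⟩]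
    ring
  · exact fun w _ hw => by rw [if_neg fun h => hw h.2.symm, mul_zero]
  · simp
  · exact fun z _ hz => Finset.sum_eq_zero fun w _ => by
      rw [if_neg fun h => hz h.1.symm, mul_zero]
  · simp

theorem frobeniusNorm_sq (A : QubitMatrix m) (hA : A.IsHermitian) :
    frobeniusNorm A ^ 2 = (A * A).trace.re := by
  have h : frobeniusNorm A ^ 2 = ∑ i, ∑ j, ‖A i j‖ ^ 2 := by
    rw [frobeniusNorm, Matrix.frobenius_norm_def, ← Real.sqrt_eq_rpow, Real.sq_sqrt]
    · simp
    · positivity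
  rw [h]
  simp only [Matrix.trace, Matrix.diag_apply, Matrix.mul_apply, Complex.re_sum]
  refine Finset.sum_congr rfl fun i _ => Finset.sum_congr rfl fun j _ => ?_
  rw [← hA.apply j i, RCLike.star_def, Complex.mul_conj, Complex.ofReal_re,
    Complex.normSq_eq_norm_sq]

theorem pauliOp_zero : pauliOp (0 : Fin m → Fin 4) = 1 := by
  ext x y
  simp [pauliOp, pauli, Matrix.one_apply, Fintype.prod_ite_zero, funext_iff]

theorem trace_mul_im_eq_zero {n : Type*} [Fintype n] {A B : Matrix n n ℂ} (hA : A.IsHermitian)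
    (hB : B.IsHermitian) : (A * B).trace.im = 0 := by
  have : star (A * B).trace = (A * B).trace := by
    rw [← Matrix.trace_conjTranspose, Matrix.conjTranspose_mul, hA.eq, hB.eq,
      Matrix.trace_mul_comm]
  exact Complex.conj_eq_iff_im.1 this

/-- Hermiticity makes the traces real, and the excluded identity label contributes `(tr A)² = 0`. -/
theorem sum_sq_re_trace_mul_pauliOp {A : QubitMatrix m} (hA : A.IsHermitian) (h0 : A.trace = 0) :
    ∑ s : PauliLabel m, (A * pauliOp s.1).trace.re ^ 2 = 2 ^ m * frobeniusNorm A ^ 2 := by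
  have h1 : ∑ s, (A * pauliOp s).trace.re ^ 2 = 2 ^ m * frobeniusNorm A ^ 2 := by
    rw [frobeniusNorm_sq A hA]
    have := congrArg Complex.re (sum_sq_trace_mul_pauliOp A)
    rw [Complex.re_sum, show (2 : ℂ) ^ m = ((2 ^ m : ℝ) : ℂ) by push_cast; rfl,
      Complex.re_ofReal_mul] at this
    rw [← this]
    refine Finset.sum_congr rfl fun s _ => ?_
    rw [pow_two, pow_two, Complex.mul_re, trace_mul_im_eq_zero hA (pauliOp_isHermitian s)]
    ring
  rw [← h1, Fintype.sum_eq_add_sum_subtype_ne _ (0 : Fin m → Fin 4), pauliOp_zero, mul_one, h0]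
  simp

end Pauli

/-! ### Mean and variance of the outcomes -/

section Binomial

theorem integral_binomial_eq_sum_bernstein (N : ℕ) (p : unitInterval) (f : ℕ → ℝ) :
    ∫ k, f k ∂(binomial N p) =
      ∑ k ∈ Finset.range (N + 1), (bernsteinPolynomial ℝ N k).eval (p : ℝ) * f k := by
  rw [integral_binomial, ← Nat.range_succ_eq_Iic]
  refine Finset.sum_congr rfl fun k _ => ?_
  simp [bernsteinPolynomial]

theorem integral_natCast_binomial (N : ℕ) (p : unitInterval) :
    ∫ k : ℕ, (k : ℝ) ∂(binomial N p) = N * p := by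
  rw [integral_binomial_eq_sum_bernstein]
  have := congrArg (Polynomial.eval (p : ℝ)) (bernsteinPolynomial.sum_smul ℝ N)
  rw [Polynomial.eval_finsetSum] at this
  simpa [mul_comm] using this

theorem integral_sq_sub_binomial (N : ℕ) (p : unitInterval) :
    ∫ k : ℕ, (N * (p : ℝ) - k) ^ 2 ∂(binomial N p) = N * p * (1 - p) := by
  rw [integral_binomial_eq_sum_bernstein]
  have := congrArg (Polynomial.eval (p : ℝ)) (bernsteinPolynomial.variance ℝ N)
  rw [Polynomial.eval_finsetSum] at this
  simpa [mul_comm, mul_assoc, mul_left_comm] using this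

theorem integral_sub_averageOutcome {N : ℕ} (hN : 1 ≤ N) (p : unitInterval) (a : ℝ) :
    ∫ k, (a - averageOutcome N k) ∂(binomial N p) = a - (2 * p - 1) := by
  have hN0 : (N : ℝ) ≠ 0 := by positivity
  have h : ∀ k : ℕ, a - averageOutcome N k = (a + 1) - 2 / N * k := by
    intro k
    rw [averageOutcome]
    field_simp
    ring
  simp only [h]
  rw [integral_sub (integrable_binomial _) (integrable_binomial _), integral_const_mul,
    integral_natCast_binomial]
  simp
  field_simp
  ring

theorem integral_sq_sub_averageOutcome {N : ℕ} (hN : 1 ≤ N) (p : unitInterval) (a : ℝ) :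
    ∫ k, (a - averageOutcome N k) ^ 2 ∂(binomial N p) =
      (a - (2 * p - 1)) ^ 2 + 4 * (p * (1 - p)) / N := by
  have hN0 : (N : ℝ) ≠ 0 := by positivity
  -- Bias–variance decomposition around the mean outcome `2 p - 1`, arranged so that only known
  -- moments appear.
  have h : ∀ k : ℕ, (a - averageOutcome N k) ^ 2 =
      2 * (a - (2 * p - 1)) * (a - averageOutcome N k)
        + (4 / N ^ 2 * (N * (p : ℝ) - k) ^ 2 - (a - (2 * p - 1)) ^ 2) := by
    intro k
    rw [averageOutcome]
    field_simp
    ring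
  simp only [h]
  rw [integral_add (integrable_binomial _) (integrable_binomial _),
    integral_sub (integrable_binomial _) (integrable_binomial _), integral_const_mul,
    integral_const_mul, integral_sub_averageOutcome hN, integral_sq_sub_binomial]
  simp
  field_simp
  ring

end Binomial

/-! ### Expected decrease in one round -/

section Round

variable {m : ℕ}

theorem card_pauliLabel (m : ℕ) : (Fintype.card (PauliLabel m) : ℝ) = (2 ^ m) ^ 2 - 1 := by
  have h : Fintype.card (PauliLabel m) = 4 ^ m - 1 := by
    rw [Fintype.card_subtype_compl]
    simp
  rw [h, Nat.cast_sub (Nat.one_le_pow _ _ (by norm_num))]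
  push_cast
  rw [← pow_mul, mul_comm m 2, pow_mul]
  norm_num

theorem lintegral_roundLaw {N : ℕ} {ρ : QubitMatrix m} (hρ : IsDensityMatrix ρ)
    (f : PauliLabel m × ℕ → ENNReal) :
    ∫⁻ x, f x ∂(roundLaw N ρ hρ) = (Fintype.card (PauliLabel m) : ENNReal)⁻¹ *
      ∑ s : PauliLabel m, ∫⁻ k, f (s, k) ∂(binomial N (bornUp ρ hρ s.1)) := by
  have : IsMarkovKernel (Kernel.ofFunOfCountable fun s : PauliLabel m =>
      binomial N (bornUp ρ hρ s.1)) :=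
    ⟨fun s => inferInstanceAs (IsProbabilityMeasure (binomial N (bornUp ρ hρ s.1)))⟩
  rw [roundLaw, Measure.lintegral_compProd .of_discrete, uniformOn, ProbabilityTheory.cond,
    Measure.restrict_univ, lintegral_smul_measure, lintegral_count, tsum_fintype,
    Measure.count_univ, ENat.card_eq_coe_fintype_card]
  rfl

theorem two_mul_bornUp_sub_one {ρ : QubitMatrix m} (hρ : IsDensityMatrix ρ) (s : Fin m → Fin 4) :
    2 * (bornUp ρ hρ s : ℝ) - 1 = (ρ * pauliOp s).trace.re := by
  change 2 * (ρ * upProj s).trace.re - 1 = _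
  rw [upProj, mul_smul_comm, mul_add, mul_one, Matrix.trace_smul, Matrix.trace_add, hρ.2,
    smul_eq_mul, show (1 / 2 : ℂ) = ((1 / 2 : ℝ) : ℂ) by push_cast; rfl, Complex.re_ofReal_mul,
    Complex.add_re, Complex.one_re]
  ring

/-- The decrease stands on the left as an added term because subtraction in `ENNReal` truncates. -/
theorem lintegral_crossEntropy_megUpdate_le (hm : 1 ≤ m) {ρ σ : QubitMatrix m}
    (hρ : IsDensityMatrix ρ) (hσ : IsGibbsState σ) {N : ℕ} (hN : 1 ≤ N) {η : ℝ}
    (hη : η ∈ Set.Icc (0 : ℝ) (1 / 2)) :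
    ∫⁻ x, ENNReal.ofReal
        (crossEntropy ρ (megUpdate σ (pauliOp x.1.1) (averageOutcome N x.2) η))
        ∂(roundLaw N ρ hρ) +
      ENNReal.ofReal (η * (2 ^ m / ((2 ^ m) ^ 2 - 1)) * frobeniusNorm (σ - ρ) ^ 2) ≤
    ENNReal.ofReal (crossEntropy ρ σ + 2 * η ^ 2 / N) := by
  have hd : (2 : ℝ) ≤ 2 ^ m := by simpa using pow_le_pow_right₀ (one_le_two (α := ℝ)) hm
  have hD : (0 : ℝ) < (2 ^ m) ^ 2 - 1 := by nlinarith
  have hNpos : (0 : ℝ) < N := by positivity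
  set u : PauliLabel m → ℝ := fun s => ((σ - ρ) * pauliOp s.1).trace.re with hu
  have hub : ∀ s : PauliLabel m,
      (σ * pauliOp s.1).trace.re - (ρ * pauliOp s.1).trace.re = u s := by
    intro s
    rw [hu]
    simp only [sub_mul, Matrix.trace_sub, Complex.sub_re]
  have hone : ∀ s : PauliLabel m, ∫⁻ k, ENNReal.ofReal
      (crossEntropy ρ (megUpdate σ (pauliOp s.1) (averageOutcome N k) η))
        ∂(binomial N (bornUp ρ hρ s.1)) ≤
      ENNReal.ofReal (crossEntropy ρ σ - η * u s ^ 2 + 2 * η ^ 2 / N) ∧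
      0 ≤ crossEntropy ρ σ - η * u s ^ 2 + 2 * η ^ 2 / N := by
    intro s
    set p := bornUp ρ hρ s.1 with hp
    have hb := two_mul_bornUp_sub_one hρ s.1
    rw [← hp] at hb
    set g : ℕ → ℝ := fun k => crossEntropy ρ σ
      - 2 * η * u s * ((σ * pauliOp s.1).trace.re - averageOutcome N k)
      + 2 * η ^ 2 * ((σ * pauliOp s.1).trace.re - averageOutcome N k) ^ 2 with hg
    have hfg : ∀ k, crossEntropy ρ (megUpdate σ (pauliOp s.1) (averageOutcome N k) η) ≤ g k := by
      intro k
      have := crossEntropy_megUpdate_le hρ.2 hσ (pauliOp_isHermitian s.1) (pauliOp_mul_self s.1)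
        (averageOutcome N k) η
      rw [hub] at this
      rw [hg]
      linarith
    have hf0 : ∀ k, 0 ≤ crossEntropy ρ (megUpdate σ (pauliOp s.1) (averageOutcome N k) η) :=
      fun k => crossEntropy_nonneg hρ (hσ.megUpdate (pauliOp_isHermitian s.1) _ _)
    have hint : ∫ k, g k ∂(binomial N p) ≤ crossEntropy ρ σ - η * u s ^ 2 + 2 * η ^ 2 / N := by
      rw [hg, integral_add (integrable_binomial _) (integrable_binomial _),
        integral_sub (integrable_binomial _) (integrable_binomial _), integral_const_mul,
        integral_const_mul, integral_sub_averageOutcome hN, integral_sq_sub_averageOutcome hN, hb,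
        hub]
      simp only [integral_const, probReal_univ, one_smul]
      have h4 : 4 * ((p : ℝ) * (1 - p)) / N ≤ 1 / N := by
        gcongr
        nlinarith [sq_nonneg (2 * (p : ℝ) - 1)]
      have h5 : 2 * η ^ 2 * (4 * ((p : ℝ) * (1 - p)) / N) ≤ 2 * η ^ 2 * (1 / N) := by gcongr
      -- The bound `η ≤ 1 / 2` lets half of the gain `2 η u²` absorb the second-order loss `2 η²
      -- u²`.
      have h6 : 0 ≤ η * (1 - 2 * η) * u s ^ 2 :=
        mul_nonneg (mul_nonneg hη.1 (by linarith [hη.2])) (sq_nonneg _)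
      have h7 : 2 * η ^ 2 * (1 / (N : ℝ)) = 2 * η ^ 2 / N := by ring
      nlinarith
    constructor
    · calc _ ≤ ∫⁻ k, ENNReal.ofReal (g k) ∂(binomial N p) :=
            lintegral_mono fun k => ENNReal.ofReal_le_ofReal (hfg k)
        _ = ENNReal.ofReal (∫ k, g k ∂(binomial N p)) :=
            (ofReal_integral_eq_lintegral_ofReal (integrable_binomial _)
              (ae_of_all _ fun k => (hf0 k).trans (hfg k))).symm
        _ ≤ _ := ENNReal.ofReal_le_ofReal hint
    · exact (integral_nonneg fun k => (hf0 k).trans (hfg k)).trans hint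
  have hcard : (Fintype.card (PauliLabel m) : ENNReal) =
      ENNReal.ofReal ((2 ^ m) ^ 2 - 1) := by
    rw [← card_pauliLabel, ENNReal.ofReal_natCast]
  have hsum : ∑ s : PauliLabel m, (crossEntropy ρ σ - η * u s ^ 2 + 2 * η ^ 2 / N) =
      ((2 ^ m) ^ 2 - 1) * (crossEntropy ρ σ + 2 * η ^ 2 / N)
        - η * (2 ^ m * frobeniusNorm (σ - ρ) ^ 2) := by
    rw [← sum_sq_re_trace_mul_pauliOp (hσ.isHermitian.sub hρ.1.1)
      (by rw [Matrix.trace_sub, hσ.trace_eq_one, hρ.2, sub_self]), ← card_pauliLabel]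
    simp only [Finset.sum_add_distrib, Finset.sum_sub_distrib, Finset.sum_const, Finset.card_univ,
      ← Finset.mul_sum, nsmul_eq_mul]
    ring
  rw [lintegral_roundLaw, hcard, ← ENNReal.ofReal_inv_of_pos hD]
  calc _ ≤ ENNReal.ofReal ((2 ^ m) ^ 2 - 1)⁻¹ * ∑ s : PauliLabel m,
          ENNReal.ofReal (crossEntropy ρ σ - η * u s ^ 2 + 2 * η ^ 2 / N) +
          ENNReal.ofReal (η * (2 ^ m / ((2 ^ m) ^ 2 - 1)) * frobeniusNorm (σ - ρ) ^ 2) := by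
        gcongr with s
        exact (hone s).1
    _ = ENNReal.ofReal (crossEntropy ρ σ + 2 * η ^ 2 / N) := by
        rw [← ENNReal.ofReal_sum_of_nonneg fun s _ => (hone s).2, ← ENNReal.ofReal_mul
          (inv_nonneg.2 hD.le), ← ENNReal.ofReal_add]
        · rw [hsum]
          congr 1
          field_simp
          ring
        · exact mul_nonneg (inv_nonneg.2 hD.le) (Finset.sum_nonneg fun s _ => (hone s).2)
        · exact mul_nonneg (mul_nonneg hη.1 (by positivity)) (sq_nonneg _)

end Round

/-! ### Integrating out a fresh round -/

section Independence

theorem ProbabilityTheory.IndepFun.lintegral_comp_prodMk {Ω α β : Type*} [MeasurableSpace Ω]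
    [MeasurableSpace α] [MeasurableSpace β] {P : Measure Ω} [IsProbabilityMeasure P]
    {μ : Measure β} {A : Ω → α} {B : Ω → β} (hA : AEMeasurable A P) (hB : HasLaw B μ P)
    (h : IndepFun A B P) {f : α × β → ENNReal} (hf : Measurable f) :
    ∫⁻ ω, f (A ω, B ω) ∂P = ∫⁻ ω, ∫⁻ b, f (A ω, b) ∂μ ∂P := by
  have hμ : IsProbabilityMeasure μ := hB.map_eq ▸ Measure.isProbabilityMeasure_map hB.aemeasurable
  have h1 := (indepFun_iff_map_prod_eq_prod_map_map hA hB.aemeasurable).1 h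
  rw [← lintegral_map' (f := f) (g := fun ω => (A ω, B ω)) hf.aemeasurable
    (hA.prodMk hB.aemeasurable), h1, hB.map_eq, lintegral_prod _ hf.aemeasurable,
    lintegral_map' hf.lintegral_prod_right'.aemeasurable hA]

end Independence

/-! ### Telescoping along the process -/

section EstimateProcess

variable {m : ℕ}

theorem nonempty_pauliLabel (hm : 1 ≤ m) : Nonempty (PauliLabel m) :=
  ⟨⟨fun _ => 1, fun h => by simpa using congrFun h ⟨0, hm⟩⟩⟩

/-- Histories form a countable discrete space, on which every function is measurable; factoring
through them settles measurability and independence of the estimate. -/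
theorem exists_megEstimate_eq_comp_history {Ω : Type*} (hm : 1 ≤ m) (η : ℕ → ℝ) (N : ℕ)
    (s : ℕ → Ω → PauliLabel m) (n : ℕ → Ω → ℕ) (t : ℕ) :
    ∃ F : (Finset.range t → PauliLabel m × ℕ) → QubitMatrix m,
      (∀ h, IsGibbsState (F h)) ∧
      ∀ ω, megEstimate η (fun k => pauliOp (s k ω).1) (fun k => averageOutcome N (n k ω)) (t + 1) =
        F (fun i => (s (i + 1) ω, n (i + 1) ω)) := by
  obtain ⟨l⟩ := nonempty_pauliLabel hm
  -- History entry `i` belongs to time `i + 1`; the padding value `(l, 0)` at later times is never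
  -- read.
  let ext : (Finset.range t → PauliLabel m × ℕ) → ℕ → PauliLabel m × ℕ := fun h k =>
    if hk : k - 1 ∈ Finset.range t then h ⟨k - 1, hk⟩ else (l, 0)
  refine ⟨fun h => megEstimate η (fun k => pauliOp (ext h k).1.1)
    (fun k => averageOutcome N (ext h k).2) (t + 1),
    fun h => isGibbsState_megEstimate (fun k => pauliOp_isHermitian _) _ _, fun ω => ?_⟩
  refine megEstimate_congr (fun k hk => ?_) (fun k hk => ?_) <;>
    simp [ext, hk]

variable {Ω : Type*} [MeasurableSpace Ω] {P : Measure Ω}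

theorem indepFun_history {E : Type*} [MeasurableSpace E] {Y : ℕ → Ω → E} (h : iIndepFun Y P)
    (hY : ∀ i, AEMeasurable (Y i) P) (t : ℕ) :
    IndepFun (fun ω (i : Finset.range t) => Y i ω) (Y t) P := by
  have h1 := h.indepFun_finset₀ (Finset.range t) {t} (by simp) hY
  exact h1.comp (φ := id) (ψ := fun g : ({t} : Finset ℕ) → E => g ⟨t, by simp⟩) measurable_id
    (measurable_pi_apply _)

variable {N : ℕ} {ρ : QubitMatrix m} {hρ : IsDensityMatrix ρ}
  {s : ℕ → Ω → PauliLabel m} {n : ℕ → Ω → ℕ} {η : ℕ → ℝ}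

theorem aemeasurable_comp_megEstimate {E : Type*} [MeasurableSpace E] (hm : 1 ≤ m)
    (hlaw : ∀ t : ℕ, 1 ≤ t → HasLaw (fun ω => (s t ω, n t ω)) (roundLaw N ρ hρ) P)
    (f : QubitMatrix m → E) (t : ℕ) :
    AEMeasurable (fun ω => f (megEstimate η (fun k => pauliOp (s k ω).1)
      (fun k => averageOutcome N (n k ω)) (t + 1))) P := by
  obtain ⟨F, -, hF⟩ := exists_megEstimate_eq_comp_history hm η N s n t
  simp only [hF]
  have hA : AEMeasurable (fun ω (i : Finset.range t) => (s (i + 1) ω, n (i + 1) ω)) P :=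
    aemeasurable_pi_lambda _ fun i => (hlaw (i + 1) (by omega)).aemeasurable
  exact (Measurable.of_discrete (f := fun h => f (F h))).comp_aemeasurable hA

theorem lintegral_crossEntropy_megEstimate_succ_le [IsProbabilityMeasure P] (hm : 1 ≤ m)
    (hN : 1 ≤ N) (hη : ∀ t, η (t + 1) ∈ Set.Icc (0 : ℝ) (1 / 2))
    (hindep : iIndepFun (fun (t : ℕ) (ω : Ω) => (s (t + 1) ω, n (t + 1) ω)) P)
    (hlaw : ∀ t : ℕ, 1 ≤ t → HasLaw (fun ω => (s t ω, n t ω)) (roundLaw N ρ hρ) P)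
    {σ : ℕ → Ω → QubitMatrix m}
    (hσ : ∀ t ω, σ t ω = megEstimate η (fun k => pauliOp (s k ω).1)
      (fun k => averageOutcome N (n k ω)) t) (t : ℕ) :
    ∫⁻ ω, ENNReal.ofReal (crossEntropy ρ (σ (t + 2) ω)) ∂P +
      ENNReal.ofReal (η (t + 1) * (2 ^ m / ((2 ^ m) ^ 2 - 1))) *
        ∫⁻ ω, ENNReal.ofReal (frobeniusNorm (σ (t + 1) ω - ρ) ^ 2) ∂P ≤
    ∫⁻ ω, ENNReal.ofReal (crossEntropy ρ (σ (t + 1) ω)) ∂P +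
      ENNReal.ofReal (2 * η (t + 1) ^ 2 / N) := by
  have hd : (2 : ℝ) ≤ 2 ^ m := by simpa using pow_le_pow_right₀ (one_le_two (α := ℝ)) hm
  have hD : (0 : ℝ) < (2 ^ m) ^ 2 - 1 := by nlinarith
  obtain ⟨F, hFG, hF⟩ := exists_megEstimate_eq_comp_history hm η N s n t
  have hA : AEMeasurable (fun ω (i : Finset.range t) => (s (i + 1) ω, n (i + 1) ω)) P :=
    aemeasurable_pi_lambda _ fun i => (hlaw (i + 1) (by omega)).aemeasurable
  have hI := indepFun_history hindep (fun i => (hlaw (i + 1) (by omega)).aemeasurable) t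
  have hstep : ∫⁻ ω, ENNReal.ofReal (crossEntropy ρ (σ (t + 2) ω)) ∂P =
      ∫⁻ ω, ∫⁻ x, ENNReal.ofReal (crossEntropy ρ (megUpdate (σ (t + 1) ω) (pauliOp x.1.1)
        (averageOutcome N x.2) (η (t + 1)))) ∂(roundLaw N ρ hρ) ∂P := by
    simp only [hσ, hF]
    rw [← hI.lintegral_comp_prodMk hA (hlaw (t + 1) (by omega))
      (f := fun z => ENNReal.ofReal (crossEntropy ρ (megUpdate (F z.1) (pauliOp z.2.1.1)
        (averageOutcome N z.2.2) (η (t + 1))))) .of_discrete]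
    simp only [megEstimate, hF]
  have hmeas : AEMeasurable (fun ω => ENNReal.ofReal (η (t + 1) * (2 ^ m / ((2 ^ m) ^ 2 - 1)) *
      frobeniusNorm (σ (t + 1) ω - ρ) ^ 2)) P := by
    simp only [hσ]
    exact aemeasurable_comp_megEstimate hm hlaw (fun τ => ENNReal.ofReal
      (η (t + 1) * (2 ^ m / ((2 ^ m) ^ 2 - 1)) * frobeniusNorm (τ - ρ) ^ 2)) t
  have hmeas' : AEMeasurable (fun ω => ENNReal.ofReal (frobeniusNorm (σ (t + 1) ω - ρ) ^ 2)) P := by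
    simp only [hσ]
    exact aemeasurable_comp_megEstimate hm hlaw
      (fun τ => ENNReal.ofReal (frobeniusNorm (τ - ρ) ^ 2)) t
  have hq : 0 ≤ η (t + 1) * (2 ^ m / ((2 ^ m) ^ 2 - 1)) := mul_nonneg (hη t).1 (by positivity)
  have hG : ∀ ω, IsGibbsState (σ (t + 1) ω) := fun ω => by rw [hσ, hF]; exact hFG _
  rw [hstep, ← lintegral_const_mul'' _ hmeas']
  simp only [← ENNReal.ofReal_mul hq]
  rw [← lintegral_add_right' _ hmeas]
  calc _ ≤ ∫⁻ ω, ENNReal.ofReal (crossEntropy ρ (σ (t + 1) ω) + 2 * η (t + 1) ^ 2 / N) ∂P :=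
        lintegral_mono fun ω => lintegral_crossEntropy_megUpdate_le hm hρ (hG ω) hN (hη t)
    _ = ∫⁻ ω, (ENNReal.ofReal (crossEntropy ρ (σ (t + 1) ω)) +
          ENNReal.ofReal (2 * η (t + 1) ^ 2 / N)) ∂P :=
        lintegral_congr fun ω => ENNReal.ofReal_add (crossEntropy_nonneg hρ (hG ω)) (by positivity)
    _ = _ := by
        rw [lintegral_add_right _ measurable_const, lintegral_const, measure_univ, mul_one]

theorem sum_lintegral_frobeniusNorm_megEstimate_le [IsProbabilityMeasure P] (hm : 1 ≤ m)
    (hN : 1 ≤ N) (hη : ∀ t, η (t + 1) ∈ Set.Icc (0 : ℝ) (1 / 2))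
    (hindep : iIndepFun (fun (t : ℕ) (ω : Ω) => (s (t + 1) ω, n (t + 1) ω)) P)
    (hlaw : ∀ t : ℕ, 1 ≤ t → HasLaw (fun ω => (s t ω, n t ω)) (roundLaw N ρ hρ) P)
    {σ : ℕ → Ω → QubitMatrix m}
    (hσ : ∀ t ω, σ t ω = megEstimate η (fun k => pauliOp (s k ω).1)
      (fun k => averageOutcome N (n k ω)) t) (T : ℕ) :
    ∑ t ∈ Finset.range T, ENNReal.ofReal (η (t + 1) * (2 ^ m / ((2 ^ m) ^ 2 - 1))) *
        ∫⁻ ω, ENNReal.ofReal (frobeniusNorm (σ (t + 1) ω - ρ) ^ 2) ∂P ≤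
      ENNReal.ofReal (Real.log (2 ^ m) + ∑ t ∈ Finset.range T, 2 * η (t + 1) ^ 2 / N) := by
  -- The induction keeps the final cross entropy, which is dropped only at the end.
  have key : ∀ T : ℕ, ∫⁻ ω, ENNReal.ofReal (crossEntropy ρ (σ (T + 1) ω)) ∂P +
      ∑ t ∈ Finset.range T, ENNReal.ofReal (η (t + 1) * (2 ^ m / ((2 ^ m) ^ 2 - 1))) *
        ∫⁻ ω, ENNReal.ofReal (frobeniusNorm (σ (t + 1) ω - ρ) ^ 2) ∂P ≤
      ENNReal.ofReal (Real.log (2 ^ m)) +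
        ∑ t ∈ Finset.range T, ENNReal.ofReal (2 * η (t + 1) ^ 2 / N) := by
    intro T
    induction T with
    | zero => simp [hσ, megEstimate, crossEntropy_maximallyMixed hρ.2]
    | succ T ih =>
      have h := lintegral_crossEntropy_megEstimate_succ_le hm hN hη hindep hlaw hσ T
      rw [Finset.sum_range_succ, Finset.sum_range_succ, add_comm (Finset.sum _ _), ← add_assoc,
        ← add_assoc]
      calc _ ≤ _ := add_le_add_left h _
        _ ≤ _ := by
          rw [add_right_comm]
          exact add_le_add_left ih _
  rw [ENNReal.ofReal_add (Real.log_nonneg (one_le_pow₀ one_le_two))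
    (Finset.sum_nonneg fun t _ => by positivity),
    ENNReal.ofReal_sum_of_nonneg fun t _ => by positivity]
  exact le_add_self.trans (key T)

end EstimateProcess

/-! ### The zeta series -/

section Rates

theorem hasSum_rpow_neg_riemannZeta_re {x : ℝ} (hx : 1 < x) :
    HasSum (fun t : ℕ => 1 / ((t : ℝ) + 1) ^ x) (riemannZeta (x : ℂ)).re := by
  have hs : Summable (fun t : ℕ => 1 / ((t : ℝ) + 1) ^ x) := by
    simpa using (summable_nat_add_iff 1).2 (Real.summable_one_div_nat_rpow.2 hx)
  have h : riemannZeta (x : ℂ) = ((∑' t : ℕ, 1 / ((t : ℝ) + 1) ^ x : ℝ) : ℂ) := by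
    rw [zeta_eq_tsum_one_div_nat_add_one_cpow (by simpa using hx), Complex.ofReal_tsum]
    refine tsum_congr fun t => ?_
    rw [Complex.ofReal_div, Complex.ofReal_cpow (by positivity)]
    push_cast
    rfl
  rw [h, Complex.ofReal_re]
  exact hs.hasSum

end Rates

/-! ### Markov's inequality at a uniform time -/

section Averaging

variable {Ω : Type*} [MeasurableSpace Ω] {P : Measure Ω}

theorem uniformOn_Icc_one_singleton {T t : ℕ} (ht : t < T) :
    uniformOn (Set.Icc 1 T) {t + 1} = (T : ENNReal)⁻¹ := by
  have h := uniformOn_apply_finset (s := Finset.Icc 1 T) (t := {t + 1})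
  rw [Finset.inter_singleton_of_mem (Finset.mem_Icc.2 ⟨by omega, ht⟩)] at h
  simpa using h

/-- Subadditivity over time slices gives an upper bound without measurability of `S`, which matters
because the data are only almost everywhere measurable. -/
theorem prod_uniformOn_Icc_le_sum [IsProbabilityMeasure P] (T : ℕ) (S : Set (Ω × ℕ)) :
    (P.prod (uniformOn (Set.Icc 1 T))) S ≤
      ∑ t ∈ Finset.range T, P {ω | (ω, t + 1) ∈ S} * (T : ENNReal)⁻¹ := by
  have hsub : S ⊆ (⋃ t ∈ Finset.range T, {ω | (ω, t + 1) ∈ S} ×ˢ {t + 1}) ∪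
      Set.univ ×ˢ (Set.Icc 1 T)ᶜ := by
    rintro ⟨ω, k⟩ hk
    by_cases h : k ∈ Set.Icc 1 T
    · left
      obtain ⟨t, rfl⟩ : ∃ t, k = t + 1 := ⟨k - 1, by have := h.1; omega⟩
      simp only [Set.mem_iUnion]
      exact ⟨t, Finset.mem_range.2 h.2, hk, rfl⟩
    · exact Or.inr ⟨trivial, h⟩
  have h0 : uniformOn (Set.Icc 1 T) (Set.Icc 1 T)ᶜ = 0 :=
    (uniformOn_eq_zero_iff (Set.finite_Icc 1 T)).2 (by simp)
  have h1 : IsZeroOrProbabilityMeasure (uniformOn (Set.Icc 1 T)) := by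
    rw [uniformOn]; infer_instance
  calc _ ≤ _ := measure_mono hsub
    _ ≤ _ := measure_union_le _ _
    _ ≤ ∑ t ∈ Finset.range T, (P.prod (uniformOn (Set.Icc 1 T)))
          ({ω | (ω, t + 1) ∈ S} ×ˢ {t + 1}) + 0 := by
        gcongr
        · exact measure_biUnion_finset_le _ _
        · rw [Measure.prod_prod, h0, mul_zero]
    _ = _ := by
        rw [add_zero]
        refine Finset.sum_congr rfl fun t ht => ?_
        rw [Measure.prod_prod, uniformOn_Icc_one_singleton (Finset.mem_range.1 ht)]

theorem one_sub_le_measureReal_of_compl_le {X : Type*} [MeasurableSpace X] {μ : Measure X}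
    [IsProbabilityMeasure μ] {S : Set X} {b : ℝ} (hb : 0 ≤ b) (h : μ Sᶜ ≤ ENNReal.ofReal b) :
    1 - b ≤ μ.real S := by
  have h1 : (1 : ENNReal) ≤ μ S + ENNReal.ofReal b := by
    rw [← measure_univ (μ := μ), ← Set.union_compl_self S]
    exact (measure_union_le _ _).trans (by gcongr)
  have h2 := ENNReal.toReal_mono (by simp) h1
  rw [ENNReal.toReal_add (by simp) (by simp), ENNReal.toReal_ofReal hb, ENNReal.toReal_one] at h2
  rw [Measure.real]
  linarith

/-- Markov's inequality, averaged over a uniform time, for a sequence of nonnegative functions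
whose integrals are summable against the weights `(t + 1) ^ (-β)`. -/
theorem one_sub_le_prod_uniformOn_real [IsProbabilityMeasure P] {f : ℕ → Ω → ℝ}
    (hf : ∀ t, AEMeasurable (f (t + 1)) P) {α β c K : ℝ} (hc : 0 < c) (hK : 0 ≤ K) {T : ℕ}
    (hαβ : 0 ≤ α + β) (hT : 1 ≤ T)
    (hsum : ∑ t ∈ Finset.range T, ENNReal.ofReal (c / ((t : ℝ) + 1) ^ β) *
      ∫⁻ ω, ENNReal.ofReal (f (t + 1) ω) ∂P ≤ ENNReal.ofReal K) :
    1 - K / c * (T : ℝ) ^ (-(1 - α - β)) ≤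
      (P.prod (uniformOn (Set.Icc 1 T))).real
        {z : Ω × ℕ | f z.2 z.1 < 1 / (z.2 : ℝ) ^ α} := by
  have hT0 : (0 : ℝ) < T := by exact_mod_cast hT
  have : IsProbabilityMeasure (uniformOn (Set.Icc 1 T)) :=
    isProbabilityMeasure_uniformOn (Set.finite_Icc 1 T) (Set.nonempty_Icc.2 hT)
  refine one_sub_le_measureReal_of_compl_le (by positivity)
    ((prod_uniformOn_Icc_le_sum T _).trans ?_)
  have hterm : ∀ t ∈ Finset.range T,
      P {ω | (ω, t + 1) ∈ {z : Ω × ℕ | f z.2 z.1 < 1 / (z.2 : ℝ) ^ α}ᶜ} * (T : ENNReal)⁻¹ ≤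
        ENNReal.ofReal ((T : ℝ) ^ (-(1 - α - β)) / c) *
          (ENNReal.ofReal (c / ((t : ℝ) + 1) ^ β) *
            ∫⁻ ω, ENNReal.ofReal (f (t + 1) ω) ∂P) := by
    intro t ht
    have ht1 : (0 : ℝ) < (t : ℝ) + 1 := by positivity
    have htT : (t : ℝ) + 1 ≤ T := by exact_mod_cast Finset.mem_range.1 ht
    have hmarkov := mul_meas_ge_le_lintegral₀ (hf t).ennreal_ofReal
      (ENNReal.ofReal (1 / ((t : ℝ) + 1) ^ α))
    have hset : {ω | (ω, t + 1) ∈ {z : Ω × ℕ | f z.2 z.1 < 1 / (z.2 : ℝ) ^ α}ᶜ} ⊆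
        {ω | ENNReal.ofReal (1 / ((t : ℝ) + 1) ^ α) ≤ ENNReal.ofReal (f (t + 1) ω)} := by
      intro ω hω
      have : 1 / ((t : ℝ) + 1) ^ α ≤ f (t + 1) ω := by simpa using hω
      exact ENNReal.ofReal_le_ofReal this
    have hone : ENNReal.ofReal (((t : ℝ) + 1) ^ α) * ENNReal.ofReal (1 / ((t : ℝ) + 1) ^ α) = 1 := by
      rw [← ENNReal.ofReal_mul (by positivity), mul_one_div_cancel (by positivity),
        ENNReal.ofReal_one]
    -- After cancellation this is `(t + 1)^(α + β) ≤ T^(α + β)`.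
    have hweight : ((t : ℝ) + 1) ^ α * (T : ℝ)⁻¹ ≤
        (T : ℝ) ^ (-(1 - α - β)) / c * (c / ((t : ℝ) + 1) ^ β) := by
      have e1 : (T : ℝ) ^ (-(1 - α - β)) / c * (c / ((t : ℝ) + 1) ^ β) =
          (T : ℝ) ^ (α + β) * (T : ℝ)⁻¹ / ((t : ℝ) + 1) ^ β := by
        rw [← Real.rpow_neg_one, ← Real.rpow_add hT0]
        rw [show α + β + -1 = -(1 - α - β) by ring]
        field_simp
      rw [e1, le_div_iff₀ (by positivity), mul_right_comm, ← Real.rpow_add ht1]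
      gcongr
    calc _ ≤ P {ω | ENNReal.ofReal (1 / ((t : ℝ) + 1) ^ α) ≤ ENNReal.ofReal (f (t + 1) ω)} *
            (T : ENNReal)⁻¹ := by gcongr
      _ = ENNReal.ofReal (((t : ℝ) + 1) ^ α * (T : ℝ)⁻¹) *
            (ENNReal.ofReal (1 / ((t : ℝ) + 1) ^ α) *
              P {ω | ENNReal.ofReal (1 / ((t : ℝ) + 1) ^ α) ≤ ENNReal.ofReal (f (t + 1) ω)}) := by
          rw [ENNReal.ofReal_mul (by positivity), ENNReal.ofReal_inv_of_pos hT0,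
            ENNReal.ofReal_natCast, mul_right_comm, ← mul_assoc, hone, one_mul]
      _ ≤ ENNReal.ofReal ((T : ℝ) ^ (-(1 - α - β)) / c * (c / ((t : ℝ) + 1) ^ β)) *
            ∫⁻ ω, ENNReal.ofReal (f (t + 1) ω) ∂P := by gcongr
      _ = _ := by rw [ENNReal.ofReal_mul (by positivity), mul_assoc]
  calc _ ≤ _ := Finset.sum_le_sum hterm
    _ ≤ ENNReal.ofReal ((T : ℝ) ^ (-(1 - α - β)) / c) * ENNReal.ofReal K := by
        rw [← Finset.mul_sum]
        gcongr
    _ = _ := by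
        rw [← ENNReal.ofReal_mul (by positivity)]
        congr 1
        ring

end Averaging

/-! ### Constants and conclusion -/

theorem mainTheorem2
    (m : ℕ) (hm : 1 ≤ m) (d : ℝ) (hd : d = 2 ^ m)
    (ρ : QubitMatrix m) (hρ : IsDensityMatrix ρ)
    (N : ℕ) (hN : 1 ≤ N)
    (δ α β η₀ : ℝ) (hδ : δ ∈ Set.Ioo (0 : ℝ) 1) (hα : α ∈ Set.Ioo (0 : ℝ) (1 / 2))
    (hβ : β ∈ Set.Ioo (1 / 2) (1 - α)) (hη₀ : η₀ ∈ Set.Ioo (0 : ℝ) (1 / 2))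
    {Ω : Type*} [MeasurableSpace Ω] (P : Measure Ω) [IsProbabilityMeasure P]
    -- the label of the observable measured at time `t` and the number of "up" outcomes
    (s : ℕ → Ω → PauliLabel m) (n : ℕ → Ω → ℕ)
    (hindep : iIndepFun (fun (t : ℕ) (ω : Ω) => (s (t + 1) ω, n (t + 1) ω)) P)
    (hlaw : ∀ t : ℕ, 1 ≤ t → HasLaw (fun ω => (s t ω, n t ω)) (roundLaw N ρ hρ) P)
    (ρhat : ℕ → Ω → QubitMatrix m)
    (hρhat : ∀ t ω, ρhat t ω = megEstimate (fun k => η₀ / (k : ℝ) ^ β)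
      (fun k => pauliOp (s k ω).1) (fun k => averageOutcome N (n k ω)) t)
    (T₀ : ℝ)
    (hT₀ : T₀ = (((d ^ 2 - 1) / (η₀ * d) *
      (Real.log d + 2 / N * (η₀ ^ 2 / (1 - 2 * η₀)) * (riemannZeta (2 * β)).re) + 2) / δ) ^
        (3 / (1 - α - β))) :
    (∀ T : ℕ, T₀ < T →
      1 - δ ≤ (P.prod (uniformOn (Set.Icc 1 T))).real
        {z : Ω × ℕ | frobeniusNorm (ρhat z.2 z.1 - ρ) ^ 2 < 1 / (z.2 : ℝ) ^ α}) ∧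
    Tendsto (fun T : ℕ => (P.prod (uniformOn (Set.Icc 1 T))).real
        {z : Ω × ℕ | frobeniusNorm (ρhat z.2 z.1 - ρ) ^ 2 < 1 / (z.2 : ℝ) ^ α})
      atTop (𝓝 1) := by
  obtain ⟨hδ0, hδ1⟩ := hδ
  obtain ⟨hα0, hα1⟩ := hα
  obtain ⟨hβ0, hβ1⟩ := hβ
  obtain ⟨hη0, hη1⟩ := hη₀
  have hd2 : 2 ≤ d := by rw [hd]; simpa using pow_le_pow_right₀ (one_le_two (α := ℝ)) hm
  have hD : 0 < d ^ 2 - 1 := by nlinarith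
  have hγ : 0 < 1 - α - β := by linarith
  have hN0 : (0 : ℝ) < N := by exact_mod_cast hN
  have hzeta := hasSum_rpow_neg_riemannZeta_re (x := 2 * β) (by linarith)
  rw [show ((2 * β : ℝ) : ℂ) = 2 * (β : ℂ) by push_cast; rfl] at hzeta
  set ζ := (riemannZeta (2 * β)).re with hζ
  have hζ0 : 0 ≤ ζ := hzeta.nonneg fun t => by positivity
  have hlog : 0 ≤ Real.log d := Real.log_nonneg (by linarith)
  set c := η₀ * (d / (d ^ 2 - 1)) with hcdef
  have hc : 0 < c := by positivity
  set K := Real.log d + 2 / N * η₀ ^ 2 * ζ with hKdef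
  have hK : 0 ≤ K := by positivity
  set A := (d ^ 2 - 1) / (η₀ * d) *
    (Real.log d + 2 / N * (η₀ ^ 2 / (1 - 2 * η₀)) * ζ) with hA
  -- The argument yields the constant `K / c`; the factor `1 / (1 - 2 η₀)` in `A` only enlarges it.
  have hKA : K / c ≤ A := by
    have e : K / c = (d ^ 2 - 1) / (η₀ * d) * K := by
      rw [hcdef]
      field_simp
    rw [e, hA, hKdef]
    have : η₀ ^ 2 ≤ η₀ ^ 2 / (1 - 2 * η₀) := le_div_self (sq_nonneg _) (by linarith) (by linarith)
    gcongr
  have hA0 : 0 ≤ A := le_trans (by positivity) hKA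
  have hηmem : ∀ t : ℕ, η₀ / ((t + 1 : ℕ) : ℝ) ^ β ∈ Set.Icc (0 : ℝ) (1 / 2) := by
    intro t
    have h1 : (1 : ℝ) ≤ ((t + 1 : ℕ) : ℝ) ^ β :=
      Real.one_le_rpow (by push_cast; linarith [t.cast_nonneg (α := ℝ)]) (by linarith)
    exact ⟨by positivity, (div_le_self hη0.le h1).trans hη1.le⟩
  have hbound : ∀ T : ℕ, 1 ≤ T → 1 - K / c * (T : ℝ) ^ (-(1 - α - β)) ≤
      (P.prod (uniformOn (Set.Icc 1 T))).real
        {z : Ω × ℕ | frobeniusNorm (ρhat z.2 z.1 - ρ) ^ 2 < 1 / (z.2 : ℝ) ^ α} := by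
    intro T hT
    refine one_sub_le_prod_uniformOn_real (f := fun t ω => frobeniusNorm (ρhat t ω - ρ) ^ 2)
      (fun t => ?_) hc hK (by linarith) hT ?_
    · simp only [hρhat]
      exact aemeasurable_comp_megEstimate hm hlaw (fun τ => frobeniusNorm (τ - ρ) ^ 2) t
    · have h := sum_lintegral_frobeniusNorm_megEstimate_le hm hN hηmem hindep hlaw hρhat T
      rw [← hd] at h
      have hle : Real.log d + ∑ t ∈ Finset.range T, 2 * (η₀ / ((t + 1 : ℕ) : ℝ) ^ β) ^ 2 / N ≤
          K := by
        have e : ∀ t : ℕ, 2 * (η₀ / ((t + 1 : ℕ) : ℝ) ^ β) ^ 2 / N =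
            2 / N * η₀ ^ 2 * (1 / ((t : ℝ) + 1) ^ (2 * β)) := by
          intro t
          rw [mul_comm 2 β, Real.rpow_mul (by positivity), Real.rpow_two]
          push_cast
          field_simp
        simp only [e, ← Finset.mul_sum]
        rw [hKdef]
        gcongr
        exact sum_le_hasSum _ (fun t _ => by positivity) hzeta
      refine le_trans (le_of_eq ?_) (h.trans (ENNReal.ofReal_le_ofReal hle))
      refine Finset.sum_congr rfl fun t _ => ?_
      congr 2
      rw [hcdef]
      push_cast
      ring
  refine ⟨fun T hT => ?_, ?_⟩
  · set B := (A + 2) / δ with hB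
    have hB1 : 1 ≤ B := by rw [hB, one_le_div hδ0]; linarith
    have hT0 : 1 ≤ T₀ := by
      rw [hT₀]
      exact Real.one_le_rpow hB1 (by positivity)
    have hT1 : 1 ≤ T := by
      have : (1 : ℝ) < T := hT0.trans_lt hT
      exact_mod_cast this.le
    refine le_trans ?_ (hbound T hT1)
    -- Only the first power of `B` is needed. The exponent `3` in `T₀` is slack since `B ≥ 1`, and
    -- so is the summand `2`.
    have hTpow : B ≤ (T : ℝ) ^ (1 - α - β) := by
      calc B ≤ B ^ (3 : ℝ) := by
            simpa using Real.rpow_le_rpow_of_exponent_le hB1 (show (1 : ℝ) ≤ 3 by norm_num)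
        _ = T₀ ^ (1 - α - β) := by
            rw [hT₀, ← Real.rpow_mul (by linarith), div_mul_cancel₀ _ hγ.ne']
        _ ≤ _ := Real.rpow_le_rpow (by linarith) hT.le hγ.le
    have hpos : 0 < (T : ℝ) ^ (1 - α - β) := by linarith
    rw [Real.rpow_neg (by positivity), ← div_eq_mul_inv, sub_le_sub_iff_left, div_le_iff₀ hpos]
    have h1 : δ * B = A + 2 := by rw [hB]; field_simp
    nlinarith
  · have hlim : Tendsto (fun T : ℕ => 1 - K / c * (T : ℝ) ^ (-(1 - α - β))) atTop (𝓝 1) := by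
      have := ((tendsto_rpow_neg_atTop hγ).comp tendsto_natCast_atTop_atTop).const_mul (K / c)
      simpa using this.const_sub 1
    refine tendsto_of_tendsto_of_tendsto_of_le_of_le' hlim tendsto_const_nhds ?_ ?_
    · filter_upwards [eventually_ge_atTop 1] with T hT using hbound T hT
    · filter_upwards [eventually_ge_atTop 1] with T hT
      have : IsProbabilityMeasure (uniformOn (Set.Icc 1 T)) :=
        isProbabilityMeasure_uniformOn (Set.finite_Icc 1 T) (Set.nonempty_Icc.2 hT)
      exact measureReal_le_one
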